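/- Let $k\ge 1$ be an integer. For real $\alpha$ let $F_\alpha$ be the bosonic Fock module of charge $\alpha$ over $\mathbb C$: the module over the Heisenberg algebra $[a_m,a_n]=m\,\delta_{m+n,0}$ ($m,n\in\mathbb Z$) with basis the monomials in the $a_{-m}$ ($m\ge 1$) applied to the Fock vacuum $|\alpha\rangle$, where $a_0|\alpha\rangle=\alpha|\alpha\rangle$ and $a_m|\alpha\rangle=0$ for $m\geq 1$. On $V=\bigoplus_{n\in\mathbb Z}F_{n\sqrt{2k}}$ let $J^0_m=a_m/\sqrt{2k}$, and let $J^\pm_m$ ($m\in\mathbb Z$) be the modes of the spin-$k$ vertex operators $$J^\pm(z)=\sum_{m\in\mathbb Z}J^\pm_m z^{-m-k}=T_{\pm\sqrt{2k}}\;z^{\pm\sqrt{2k}\,a_0}\,\exp\Big(\pm\sqrt{2k}\sum_{m>0}\tfrac{a_{-m}}{m}z^m\Big)\exp\Big(\mp\sqrt{2k}\sum_{m>0}\tfrac{a_m}{m}z^{-m}\Big),$$ where $z^{\pm\sqrt{2k}\,a_0}$ acts on $F_{n\sqrt{2k}}$ as $z^{\pm 2kn}$, and $T_\beta$ maps $F_\alpha$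 to $F_{\alpha+\beta}$, commutes with all $a_m$, $m\ne 0$, and sends $|\alpha\rangle$ to $|\alpha+\beta\rangle$. Let $L_0=\frac12a_0^2+\sum_{m>0}a_{-m}a_m$. Then: (i) the modes $J^+_m,J^-_m,J^0_m$ ($m\in\mathbb Z$) generate $V$ from the charge-zero vacuum: applying all elements of the algebra generated by these operators to $|0\rangle$ yields all of $V=\bigoplus_{n\in\mathbb Z}F_{n\sqrt{2k}}$; (ii) the character of $V$ is $\chi_0$: $L_0$ is diagonalizable on $V$ with finite-dimensional eigenspaces $V_h$, and for every $\tau$ in the upper half plane, with $q^x=e^{2\pi i\tau x}$, $$\sum_{h}\dim(V_h)\,q^{h-1/24}=\chi_0(q)=\frac{\sum_{n\in\mathbb Z}q^{kn^2}}{\eta(q)},$$ where both series converge absolutely and $\eta(q)=q^{1/24}\prod_{n\ge1}(1-q^n)$; (iii) for either choice of sign and every integer $n\ge 0$ (the product being empty for $n=0$), $$J^\pm_{-(2n-1)k}\cdots J^\pm_{-3k}J^\pm_{-k}|0\rangle=|\pm n\sqrt{2k}\rangle .$$ -/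

import Mathlib

open scoped DirectSum UpperHalfPlane

noncomputable section

namespace ChiralBoson

/-- The vector space underlying each Fock module: polynomials in the commuting creation
operators `a_{-m}`, `m ≥ 1` (the variable `X m` is `a_{-m}`); `1` is the Fock vacuum. -/
abbrev Osc : Type := MvPolynomial ℕ+ ℂ

/-- The Fock module `F_α` of charge `α`, on which `a_0` acts as `α`. As a vector space it does
not depend on `α`. -/
abbrev Fock (_α : ℝ) : Type := Osc

/-- The creation operator `a_{-m}`, `m ≥ 1`. -/
def create (m : ℕ+) : Module.End ℂ Osc :=
  LinearMap.mulLeft ℂ (MvPolynomial.X m)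

/-- The annihilation operator `a_m`, `m ≥ 1`: it kills `1` and satisfies `[a_m, a_{-m}] = m`. -/
def annih (m : ℕ+) : Module.End ℂ Osc :=
  (m : ℂ) • (MvPolynomial.pderiv (R := ℂ) m).toLinearMap

/-- The Heisenberg operator `a_n`, `n ∈ ℤ`, on `F_α`. -/
def heis (α : ℝ) : ℤ → Module.End ℂ (Fock α)
  | .ofNat 0 => (α : ℂ) • 1
  | .ofNat (n + 1) => annih n.succPNat
  | .negSucc n => create n.succPNat

/-- The sum of a pointwise finite family of linear maps. -/
def pointwiseSum {ι M N : Type*} [AddCommGroup M] [Module ℂ M] [AddCommGroup N] [Module ℂ N]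
    (f : ι → M →ₗ[ℂ] N) (hf : ∀ v, (Function.support fun i => f i v).Finite) : M →ₗ[ℂ] N where
  toFun v := ∑ᶠ i, f i v
  map_add' v w := by
    simp only [map_add]
    exact finsum_add_distrib (hf v) (hf w)
  map_smul' c v := by
    simp only [map_smul, RingHom.id_apply]
    exact (smul_finsum' c (hf v)).symm

/-- The `N`-th coefficient of `exp f = ∑_j f^j / j!`, for a power series `f` with zero constant
term whose coefficients are operators (the terms with `j > N` do not contribute). -/
def expCoeff (f : PowerSeries (Module.End ℂ Osc)) (N : ℕ) : Module.End ℂ Osc :=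
  ∑ j ∈ Finset.range (N + 1), ((j.factorial : ℂ)⁻¹) • PowerSeries.coeff N (f ^ j)

/-- `β ∑_{m > 0} (a_{-m} / m) z^m`, a power series in `z`. -/
def creationExponent (β : ℝ) : PowerSeries (Module.End ℂ Osc) :=
  PowerSeries.mk fun m => if h : 0 < m then ((β : ℂ) / m) • create ⟨m, h⟩ else 0

/-- `-β ∑_{m > 0} (a_m / m) w^m`, a power series in `w = z⁻¹`. -/
def annihilationExponent (β : ℝ) : PowerSeries (Module.End ℂ Osc) :=
  PowerSeries.mk fun m => if h : 0 < m then (-(β : ℂ) / m) • annih ⟨m, h⟩ else 0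

/-- Polynomials of weighted degree at most `D`, where `X m` has weight `m`. -/
def lowLevel (D : ℤ) : Submodule ℂ Osc :=
  MvPolynomial.restrictSupport ℂ
    {d : ℕ+ →₀ ℕ | ((Finsupp.weight (fun m : ℕ+ => (m : ℕ)) d : ℕ) : ℤ) ≤ D}

/-- The operator `T` lowers the level by `M`. -/
def Lowers (T : Module.End ℂ Osc) (M : ℕ) : Prop :=
  ∀ (D : ℤ) (p : Osc), p ∈ lowLevel D → T p ∈ lowLevel (D - M)

theorem mem_lowLevel {D : ℤ} {p : Osc} :
    p ∈ lowLevel D ↔ ∀ d, p.coeff d ≠ 0 →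
      ((Finsupp.weight (fun m : ℕ+ => (m : ℕ)) d : ℕ) : ℤ) ≤ D := by
  unfold lowLevel
  rw [MvPolynomial.mem_restrictSupport_iff]
  constructor
  · intro h d hd
    exact h (by simpa using hd)
  · intro h d hd
    exact h d (by simpa using hd)

theorem exists_mem_lowLevel (p : Osc) : ∃ D : ℕ, p ∈ lowLevel D := by
  refine ⟨p.support.sup fun d => Finsupp.weight (fun m : ℕ+ => (m : ℕ)) d, ?_⟩
  rw [mem_lowLevel]
  intro d hd
  exact_mod_cast Finset.le_sup (f := fun d => Finsupp.weight (fun m : ℕ+ => (m : ℕ)) d)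
    (MvPolynomial.mem_support_iff.2 hd)

theorem eq_zero_of_mem_lowLevel {D : ℤ} (hD : D < 0) {p : Osc} (hp : p ∈ lowLevel D) : p = 0 := by
  ext d
  by_contra h
  have := mem_lowLevel.1 hp d (by simpa using h)
  omega

theorem lowers_annih (m : ℕ+) : Lowers (annih m) m := by
  intro D p hp
  rw [mem_lowLevel] at hp ⊢
  intro d hd
  have h : p.coeff (d + Finsupp.single m 1) ≠ 0 := by
    intro h0
    apply hd
    simp [annih, MvPolynomial.coeff_pderiv, h0]
  have := hp _ h
  rw [map_add, Finsupp.weight_single] at this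
  push_cast at this
  simp at this
  linarith

theorem Lowers.mul {S T : Module.End ℂ Osc} {M N : ℕ} (hS : Lowers S M) (hT : Lowers T N) :
    Lowers (S * T) (M + N) := by
  intro D p hp
  have := hS _ _ (hT _ _ hp)
  rw [sub_sub, add_comm (N : ℤ)] at this
  simpa using this

theorem Lowers.smul {T : Module.End ℂ Osc} {M : ℕ} (c : ℂ) (hT : Lowers T M) :
    Lowers (c • T) M :=
  fun D p hp => (lowLevel _).smul_mem c (hT D p hp)

theorem Lowers.sum {ι : Type*} {s : Finset ι} {T : ι → Module.End ℂ Osc} {M : ℕ}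
    (hT : ∀ i ∈ s, Lowers (T i) M) : Lowers (∑ i ∈ s, T i) M := by
  intro D p hp
  rw [LinearMap.sum_apply]
  exact Submodule.sum_mem _ fun i hi => hT i hi D p hp

theorem lowers_coeff_pow (β : ℝ) (j M : ℕ) :
    Lowers (PowerSeries.coeff M (annihilationExponent β ^ j)) M := by
  induction j generalizing M with
  | zero =>
    intro D p hp
    rw [pow_zero, PowerSeries.coeff_one]
    split_ifs with h
    · subst h
      simpa using hp
    · simp
  | succ j ih =>
    rw [pow_succ, PowerSeries.coeff_mul]
    refine Lowers.sum fun x hx => ?_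
    rw [← Finset.HasAntidiagonal.mem_antidiagonal.1 hx]
    refine (ih _).mul ?_
    rw [annihilationExponent, PowerSeries.coeff_mk]
    split_ifs with h
    · exact (lowers_annih ⟨x.2, h⟩).smul _
    · intro D p _
      simp

theorem lowers_expCoeff (β : ℝ) (M : ℕ) : Lowers (expCoeff (annihilationExponent β) M) M :=
  Lowers.sum fun j _ => (lowers_coeff_pow β j M).smul _

/-- The summand `A_{M+r} B_M` of `vertexCoeff`, with `A_N = 0` for `N < 0`. -/
def vertexTerm (β : ℝ) (r : ℤ) (M : ℕ) : Module.End ℂ Osc :=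
  if 0 ≤ (M : ℤ) + r then
    expCoeff (creationExponent β) ((M : ℤ) + r).toNat * expCoeff (annihilationExponent β) M
  else 0

theorem vertexTerm_finite (β : ℝ) (r : ℤ) (v : Osc) :
    (Function.support fun M => vertexTerm β r M v).Finite := by
  obtain ⟨D, hD⟩ := exists_mem_lowLevel v
  refine (Set.finite_Iic D).subset fun M hM => ?_
  by_contra h
  rw [Set.mem_Iic, not_le] at h
  apply hM
  have h0 := eq_zero_of_mem_lowLevel (by omega) (lowers_expCoeff β M D v hD)
  simp only [vertexTerm]
  split_ifs
  · simp [h0]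
  · simp

/-- The coefficient of `z^r` in the oscillator part
`exp(β ∑_{m>0} a_{-m} z^m / m) exp(-β ∑_{m>0} a_m z^{-m} / m)` of the vertex operator of charge
`β`: with `A_N`, `B_M` the coefficients of the two factors, it is `∑_M A_{M+r} B_M`. -/
def vertexCoeff (β : ℝ) (r : ℤ) : Module.End ℂ Osc :=
  pointwiseSum (vertexTerm β r) (vertexTerm_finite β r)

theorem number_finite (v : Osc) :
    (Function.support fun m : ℕ+ => (create m * annih m) v).Finite := by
  classical
  refine v.vars.finite_toSet.subset fun m hm => ?_
  by_contra h
  apply hm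
  simp [annih, MvPolynomial.pderiv_eq_zero_of_notMem_vars h]

/-- `L_0 = (1/2) a_0² + ∑_{m>0} a_{-m} a_m` on `F_α`. -/
def fockL0 (α : ℝ) : Module.End ℂ (Fock α) :=
  (1 / 2 : ℂ) • (heis α 0 * heis α 0) + pointwiseSum (fun m : ℕ+ => create m * annih m) number_finite

/-- The charge `n √(2k)`. -/
def charge (k : ℕ) (n : ℤ) : ℝ := n * Real.sqrt (2 * k)

/-- The space `⨁_{n ∈ ℤ} F_{n √(2k)}`. -/
abbrev Space (k : ℕ) : Type := ⨁ n : ℤ, Fock (charge k n)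

/-- The inclusion of the summand `F_{n √(2k)}`. -/
def incl (k : ℕ) (n : ℤ) : Fock (charge k n) →ₗ[ℂ] Space k :=
  DirectSum.lof ℂ ℤ (fun n => Fock (charge k n)) n

/-- The highest weight vector `|n √(2k)⟩` (the Fock vacuum of `F_{n √(2k)}`). -/
def hwv (k : ℕ) (n : ℤ) : Space k := incl k n (1 : Osc)

/-- `L_0` on the whole space. -/
def L0 (k : ℕ) : Module.End ℂ (Space k) :=
  DirectSum.toModule ℂ ℤ (Space k) fun n => incl k n ∘ₗ fockL0 (charge k n)

/-- The mode `J^0_m = a_m / √(2k)` of `J^0(z) = i ∂φ(z) / √(2k) = ∑_m J^0_m z^{-m-1}`. -/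
def J0 (k : ℕ) (m : ℤ) : Module.End ℂ (Space k) :=
  DirectSum.toModule ℂ ℤ (Space k) fun n =>
    incl k n ∘ₗ (((Real.sqrt (2 * k) : ℝ) : ℂ)⁻¹ • heis (charge k n) m)

/-- The mode `J^±_m` of `J^±(z) = e^{± i √(2k) φ(z)} = ∑_m J^±_m z^{-m-k}`, with `s = ±1` the sign.
On `F_α`, `α = n √(2k)`, the vertex operator of charge `β = s √(2k)` maps to `F_{α+β}`, and its
zero mode factor is `z^{β α} = z^{2 k s n}`; so `J^±_m` acts there as the coefficient of
`z^{-m-k-2ksn}` of the oscillator part. -/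
def J (k : ℕ) (s : ℤˣ) (m : ℤ) : Module.End ℂ (Space k) :=
  DirectSum.toModule ℂ ℤ (Space k) fun n =>
    incl k (n + s) ∘ₗ vertexCoeff (charge k s) (-m - k - 2 * k * s * n)

/-- The algebra of operators generated by all modes of the currents `J^+`, `J^-`, `J^0`. -/
def currentAlgebra (k : ℕ) : Subalgebra ℂ (Module.End ℂ (Space k)) :=
  Algebra.adjoin ℂ
    (Set.range (J k 1) ∪ Set.range (J k (-1)) ∪ Set.range (J0 k))

/-- The subspace generated from a vector `v` by the modes of the currents. -/
def generated (k : ℕ) (v : Space k) : Submodule ℂ (Space k) :=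
  (Subalgebra.toSubmodule (currentAlgebra k)).map (LinearMap.applyₗ v)

/-- `H` is diagonalizable with finite-dimensional eigenspaces, and at every `τ` in the upper half
plane `χ τ` is the (absolutely convergent) trace of `q^{H - 1/24}`, `q = e^{2πiτ}`. -/
def IsCharacter {V : Type*} [AddCommGroup V] [Module ℂ V] (H : Module.End ℂ V) (χ : ℍ → ℂ) :
    Prop :=
  (⨆ h : ℂ, H.eigenspace h) = ⊤ ∧
  (∀ h : ℂ, FiniteDimensional ℂ (H.eigenspace h)) ∧
  ∀ τ : ℍ, HasSum (fun h : ℂ => (Module.finrank ℂ (H.eigenspace h) : ℂ) *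
    Complex.exp (2 * Real.pi * Complex.I * τ * (h - 1 / 24))) (χ τ)

/-- `q^{k n²}` with `q = e^{2πiτ}`. -/
def thetaTerm (k : ℕ) (τ : ℍ) (n : ℤ) : ℂ :=
  Complex.exp (2 * Real.pi * Complex.I * τ * (k * (n : ℂ) ^ 2))

/-- `χ_0(q) = ∑_{n ∈ ℤ} q^{k n²} / η(q)`, `q = e^{2πiτ}`, with `η` the Dedekind eta function. -/
def chi0 (k : ℕ) (τ : ℍ) : ℂ := (∑' n : ℤ, thetaTerm k τ n) / ModularForm.eta τ

end ChiralBoson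

end

/-! The engine is `vertexCoeff_zero_one`: the `z^0` coefficient of the oscillator part fixes the
Fock vacuum, since every annihilating coefficient of positive order kills it. The mode of `J^±` that
picks out this coefficient thus moves one highest weight vector to the next, which gives (iii)
(`prod_J_hwv`). From these vectors the `J^0_{-m}`, nonzero multiples of `a_{-m}`, build every
monomial, which gives (i) (`generated_hwv_zero`).

For (ii), the monomials are an eigenbasis of `L0` with eigenvalues `k n² + weight`
(`L0_monomialBasis`). The sum over this basis factors into a theta series and Euler's partition
series (`hasSum_pow_weight`), and `IsCharacter.of_basis` regroups it by eigenvalue. -/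

/-! ### Euler's product for the partition generating function -/

/-- Removing one index from the domain of finitely supported exponent vectors. -/
noncomputable def Finsupp.supportInsertEquiv {ι : Type*} [DecidableEq ι] {a : ι} {s : Finset ι} (ha : a ∉ s) :
    ℕ × {d : ι →₀ ℕ // d.support ⊆ s} ≃ {d : ι →₀ ℕ // d.support ⊆ insert a s} where
  toFun x := ⟨Finsupp.single a x.1 + x.2.1, by
    refine Finsupp.support_add.trans (Finset.union_subset ?_ ?_)
    · exact Finsupp.support_single_subset.trans (by simp)
    · exact x.2.2.trans (Finset.subset_insert _ _)⟩
  invFun d := ⟨d.1 a, d.1.erase a, by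
    rw [Finsupp.support_erase, ← Finset.subset_insert_iff]
    exact d.2⟩
  left_inv := by
    rintro ⟨e, d, hd⟩
    have h0 : d a = 0 := Finsupp.notMem_support_iff.1 fun h => ha (hd h)
    ext i
    · simp [h0]
    · by_cases hi : i = a
      · subst hi; simp [h0]
      · simp [Finsupp.erase_ne hi]
  right_inv := by
    rintro ⟨d, hd⟩
    ext1
    exact Finsupp.single_add_erase a d

/-- Induction on `s`: splitting off one exponent contributes a geometric series. Absolute
summability is carried along because multiplying two sums requires it. -/
theorem summable_hasSum_prod_pow_of_support_subset {ι F : Type*} [NormedField F] [CompleteSpace F]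
    {f : ι → F} (hf : ∀ i, ‖f i‖ < 1) (s : Finset ι) :
    Summable (fun d : {d : ι →₀ ℕ // d.support ⊆ s} => ‖d.1.prod fun i e => f i ^ e‖) ∧
      HasSum (fun d : {d : ι →₀ ℕ // d.support ⊆ s} => d.1.prod fun i e => f i ^ e)
        (∏ i ∈ s, (1 - f i)⁻¹) := by
  classical
  induction s using Finset.induction_on with
  | empty =>
    have : Unique {d : ι →₀ ℕ // d.support ⊆ ∅} :=
      { default := ⟨0, by simp⟩
        uniq := fun d => Subtype.ext (by simpa using d.2) }
    refine ⟨(hasSum_fintype _).summable, ?_⟩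
    have h := hasSum_unique (fun d : {d : ι →₀ ℕ // d.support ⊆ ∅} => d.1.prod fun i e => f i ^ e)
    have h0 : (default : {d : ι →₀ ℕ // d.support ⊆ ∅}).1 = 0 := by
      simpa using (default : {d : ι →₀ ℕ // d.support ⊆ ∅}).2
    simpa [h0] using h
  | insert a s ha ih =>
    have key : ∀ x : ℕ × {d : ι →₀ ℕ // d.support ⊆ s},
        ((Finsupp.supportInsertEquiv ha x).1.prod fun i e => f i ^ e) =
          f a ^ x.1 * x.2.1.prod fun i e => f i ^ e := by
      rintro ⟨e, d⟩
      change ((Finsupp.single a e + d.1).prod fun i e => f i ^ e) = _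
      rw [Finsupp.prod_add_index' (by simp) (by simp [pow_add]), Finsupp.prod_single_index (by simp)]
    have hg : Summable fun n : ℕ => ‖f a ^ n‖ := by
      simpa using summable_geometric_of_lt_one (norm_nonneg _) (hf a)
    rw [← (Finsupp.supportInsertEquiv ha).summable_iff, ← (Finsupp.supportInsertEquiv ha).hasSum_iff]
    simp only [Function.comp_def, key, Finset.prod_insert ha]
    constructor
    · simpa only [norm_mul] using hg.mul_of_nonneg ih.1 (fun _ => norm_nonneg _)
        (fun _ => norm_nonneg _)
    · have : T3Space F := instT3Space
      apply (hasSum_geometric_of_norm_lt_one (hf a)).mul ih.2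
      apply summable_mul_of_summable_norm hg ih.1

/-- A finite set of exponent vectors involves finitely many indices, so its partial sum is at most a
finite product of `(1 - ‖f i‖)⁻¹`. An exponential bound on each factor makes this uniform. -/
theorem summable_norm_prod_pow {ι F : Type*} [NormedField F]
    {f : ι → F} {r : ℝ} (hr : r < 1) (hfr : ∀ i, ‖f i‖ ≤ r) (hf : Summable fun i => ‖f i‖) :
    Summable fun d : ι →₀ ℕ => ‖d.prod fun i e => f i ^ e‖ := by
  classical
  refine summable_of_sum_le (c := Real.exp (∑' i, ‖f i‖ * (1 - r)⁻¹)) (fun _ => norm_nonneg _) ?_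
  intro u
  have hlt : ∀ i, ‖(‖f i‖ : ℝ)‖ < 1 := fun i => by simpa using (hfr i).trans_lt hr
  have hr' : 0 < 1 - r := by linarith
  obtain ⟨h1, h2⟩ := summable_hasSum_prod_pow_of_support_subset hlt (u.biUnion Finsupp.support)
  let v := u.subtype fun d => d.support ⊆ u.biUnion Finsupp.support
  calc ∑ d ∈ u, ‖d.prod fun i e => f i ^ e‖
      = ∑ d ∈ u, d.prod fun i e => ‖f i‖ ^ e := by
        refine Finset.sum_congr rfl fun d _ => ?_
        simp [Finsupp.prod, norm_prod]
    _ = ∑ d ∈ v, d.1.prod fun i e => ‖f i‖ ^ e :=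
        (Finset.sum_subtype_of_mem (fun d : ι →₀ ℕ => d.prod fun i e => ‖f i‖ ^ e)
          fun d hd => Finset.subset_biUnion_of_mem Finsupp.support hd).symm
    _ ≤ ∏ i ∈ u.biUnion Finsupp.support, (1 - ‖f i‖)⁻¹ :=
        sum_le_hasSum v (fun d _ => Finset.prod_nonneg fun i _ => pow_nonneg (norm_nonneg _) _) h2
    _ ≤ ∏ i ∈ u.biUnion Finsupp.support, Real.exp (‖f i‖ * (1 - r)⁻¹) := by
        have hpos : ∀ i, 0 < 1 - ‖f i‖ := fun i => by linarith [hfr i]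
        refine Finset.prod_le_prod (fun i _ => (inv_pos.2 (hpos i)).le) fun i _ => ?_
        refine le_trans ?_ (Real.add_one_le_exp _)
        -- With `x = ‖f i‖ ≤ r`: `(1 - x)⁻¹ = 1 + x (1 - x)⁻¹ ≤ 1 + x (1 - r)⁻¹`.
        have : (1 - ‖f i‖)⁻¹ = ‖f i‖ * (1 - ‖f i‖)⁻¹ + 1 := by
          field_simp [(hpos i).ne']
          ring
        rw [this]
        gcongr
        exact hfr i
    _ = Real.exp (∑ i ∈ u.biUnion Finsupp.support, ‖f i‖ * (1 - r)⁻¹) := (Real.exp_sum _ _).symm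
    _ ≤ _ := Real.exp_le_exp.2 ((hf.mul_right _).sum_le_tsum _ fun i _ =>
        mul_nonneg (norm_nonneg _) (inv_pos.2 hr').le)

/-- The generating function of finitely supported exponent vectors is `∏ (1 - f i)⁻¹`. -/
theorem hasProd_inv_one_sub_tsum_prod_pow {ι F : Type*} [NormedField F] [CompleteSpace F]
    {f : ι → F} {r : ℝ} (hr : r < 1) (hfr : ∀ i, ‖f i‖ ≤ r) (hf : Summable fun i => ‖f i‖) :
    HasProd (fun i => (1 - f i)⁻¹) (∑' d : ι →₀ ℕ, d.prod fun i e => f i ^ e) := by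
  classical
  have h : ∀ s : Finset ι, ∏ i ∈ s, (1 - f i)⁻¹ =
      ∑' d, {d : ι →₀ ℕ | d.support ⊆ s}.indicator (fun d => d.prod fun i e => f i ^ e) d := by
    intro s
    rw [← tsum_subtype]
    exact (summable_hasSum_prod_pow_of_support_subset
      (fun i => (hfr i).trans_lt hr) s).2.tsum_eq.symm
  rw [HasProd, SummationFilter.unconditional_filter]
  simp_rw [h]
  -- The partial product over `s` is the sum over vectors supported in `s`. Each vector is
  -- eventually included, and the norms of the full series dominate.
  refine tendsto_tsum_of_dominated_convergence (summable_norm_prod_pow hr hfr hf) ?_ ?_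
  · intro d
    refine tendsto_const_nhds.congr' ?_
    filter_upwards [Filter.eventually_ge_atTop d.support] with s hs
    rw [Set.indicator_of_mem]
    exact hs
  · exact .of_forall fun s d => norm_indicator_le_norm_self _ _

/-- Euler's generating function of partitions, a partition being given by its multiplicities. -/
theorem hasSum_pow_weight {q : ℂ} (hq : ‖q‖ < 1) :
    Summable (fun d : ℕ+ →₀ ℕ => ‖q ^ Finsupp.weight (fun m : ℕ+ => (m : ℕ)) d‖) ∧
    HasSum (fun d : ℕ+ →₀ ℕ => q ^ Finsupp.weight (fun m : ℕ+ => (m : ℕ)) d)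
      (∏' n : ℕ, (1 - q ^ (n + 1)))⁻¹ := by
  have hw : ∀ d : ℕ+ →₀ ℕ, q ^ Finsupp.weight (fun m : ℕ+ => (m : ℕ)) d =
      d.prod fun i e => (q ^ (i : ℕ)) ^ e := by
    intro d
    rw [Finsupp.weight_apply, Finsupp.sum, ← Finset.prod_pow_eq_pow_sum]
    refine Finset.prod_congr rfl fun i _ => ?_
    simp only [smul_eq_mul]
    rw [← pow_mul, mul_comm]
  simp_rw [hw]
  have hle : ∀ i : ℕ+, ‖q ^ (i : ℕ)‖ ≤ ‖q‖ := fun i => by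
    rw [norm_pow]
    exact pow_le_of_le_one (norm_nonneg _) hq.le i.ne_zero
  have hs : Summable fun i : ℕ+ => ‖q ^ (i : ℕ)‖ := by
    simp_rw [norm_pow]
    exact (summable_geometric_of_lt_one (norm_nonneg _) hq).comp_injective PNat.coe_injective
  have h1 := summable_norm_prod_pow hq hle hs
  refine ⟨h1, ?_⟩
  have h2 := hasProd_inv_one_sub_tsum_prod_pow hq hle hs
  have h3 : HasProd (fun i : ℕ+ => 1 - q ^ (i : ℕ)) (∏' n : ℕ, (1 - q ^ (n + 1))) := by
    rw [← Equiv.pnatEquivNat.symm.hasProd_iff]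
    simpa [Function.comp_def] using (ModularForm.multipliable_one_sub_pow hq).hasProd
  -- Nonvanishing of the infinite product lets its limit be inverted; uniqueness of limits then
  -- identifies the partition sum.
  have hne : ∏' n : ℕ, (1 - q ^ (n + 1)) ≠ 0 := by
    simp_rw [sub_eq_add_neg]
    refine tprod_one_add_ne_zero_of_summable ?_ ?_
    · intro n h
      have : q ^ (n + 1) = 1 := by linear_combination -h
      have h' : ‖q‖ ^ (n + 1) < 1 := pow_lt_one₀ (norm_nonneg _) hq (by simp)
      rw [← norm_pow, this] at h'
      simp at h'
    · simpa using (summable_nat_add_iff 1).2 (summable_geometric_of_lt_one (norm_nonneg _) hq)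
  have h4 : HasProd (fun i : ℕ+ => (1 - q ^ (i : ℕ))⁻¹) (∏' n : ℕ, (1 - q ^ (n + 1)))⁻¹ := by
    have := Filter.Tendsto.inv₀ h3 hne
    rw [HasProd]
    simpa using this
  rw [← h2.unique h4]
  exact h1.of_norm.hasSum

/-! ### Characters computed from an eigenbasis -/

section Diagonal

variable {V ι : Type*} [AddCommGroup V] [Module ℂ V] {H : Module.End ℂ V}

/-- `H` multiplies the `i`-th coordinate by `w i`, so an eigenvector for `h` has nonzero coordinates
only where `w i = h`. -/
theorem Module.End.eigenspace_eq_span_of_basis (b : Module.Basis ι ℂ V) {w : ι → ℂ}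
    (hb : ∀ i, H (b i) = w i • b i) (h : ℂ) :
    H.eigenspace h = Submodule.span ℂ (b '' (w ⁻¹' {h})) := by
  have hrepr : ∀ x i, b.repr (H x) i = w i * b.repr x i := by
    intro x i
    have : (Finsupp.lapply i ∘ₗ b.repr.toLinearMap ∘ₗ H : V →ₗ[ℂ] ℂ) =
        w i • (Finsupp.lapply i ∘ₗ b.repr.toLinearMap) := by
      refine b.ext fun j => ?_
      by_cases hij : j = i
      · subst hij; simp [hb]
      · simp [hb, hij]
    simpa using LinearMap.congr_fun this x
  ext x
  rw [Module.End.mem_eigenspace_iff, b.mem_span_image]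
  constructor
  · intro hx i hi
    have h1 := hrepr x i
    rw [hx, map_smul, Finsupp.smul_apply, smul_eq_mul] at h1
    exact (mul_right_cancel₀ (Finsupp.mem_support_iff.1 hi) h1).symm
  · intro hx
    refine b.ext_elem fun i => ?_
    rw [hrepr, map_smul, Finsupp.smul_apply, smul_eq_mul]
    by_cases hi : b.repr x i = 0
    · simp [hi]
    · rw [show w i = h from hx (Finsupp.mem_support_iff.2 hi)]

theorem ChiralBoson.IsCharacter.of_basis (b : Module.Basis ι ℂ V) {w : ι → ℂ}
    (hb : ∀ i, H (b i) = w i • b i) {χ : ℍ → ℂ}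
    (hχ : ∀ τ : ℍ, HasSum (fun i => Complex.exp (2 * Real.pi * Complex.I * τ * (w i - 1 / 24)))
      (χ τ)) :
    ChiralBoson.IsCharacter H χ := by
  have hfin : ∀ h, (w ⁻¹' {h}).Finite := by
    intro h
    by_contra hinf
    -- Finiteness of the fibres follows from convergence at a single `τ`: an infinite fibre would
    -- make a nonzero constant family summable.
    have : Infinite (w ⁻¹' {h}) := Set.infinite_coe_iff.2 hinf
    have h1 := (hχ UpperHalfPlane.I).summable.comp_injective
      (Subtype.val_injective (p := (· ∈ w ⁻¹' {h})))
    have h2 : ((fun i => Complex.exp (2 * Real.pi * Complex.I * (UpperHalfPlane.I : ℍ) *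
        (w i - 1 / 24))) ∘ Subtype.val : (w ⁻¹' {h}) → ℂ) = fun _ =>
          Complex.exp (2 * Real.pi * Complex.I * (UpperHalfPlane.I : ℍ) * (h - 1 / 24)) := by
      funext i
      simp only [Function.comp_apply]
      rw [show w i = h from i.2]
    rw [h2, summable_const_iff] at h1
    exact Complex.exp_ne_zero _ h1
  have heig := Module.End.eigenspace_eq_span_of_basis b hb
  refine ⟨?_, fun h => ?_, fun τ => ?_⟩
  · rw [eq_top_iff, ← b.span_eq, Submodule.span_le]
    rintro _ ⟨i, rfl⟩
    exact Submodule.mem_iSup_of_mem (w i) (Module.End.mem_eigenspace_iff.2 (hb i))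
  · rw [heig]
    exact FiniteDimensional.span_of_finite ℂ ((hfin h).image _)
  -- Summing first over the fibres of `w` turns each fibre into its cardinality, the dimension of
  -- the eigenspace, times a constant exponential.
  · refine HasSum.sigma ((Equiv.sigmaFiberEquiv w).hasSum_iff.2 (hχ τ)) fun h => ?_
    have : Fintype {i // w i = h} := (hfin h).fintype
    have hcard : Module.finrank ℂ (H.eigenspace h) = Fintype.card {i // w i = h} := by
      rw [heig, Set.image_eq_range]
      exact finrank_span_eq_card (b := fun i : {i // w i = h} => b i)
        (b.linearIndependent.comp _ Subtype.val_injective)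
    have hconst : ∀ i : {i // w i = h},
        ((fun i => Complex.exp (2 * Real.pi * Complex.I * τ * (w i - 1 / 24))) ∘
          Equiv.sigmaFiberEquiv w) ⟨h, i⟩ =
        Complex.exp (2 * Real.pi * Complex.I * τ * (h - 1 / 24)) := by
      rintro ⟨i, rfl⟩
      rfl
    simp_rw [hconst, hcard]
    simpa using hasSum_fintype fun _ : {i // w i = h} =>
      Complex.exp (2 * Real.pi * Complex.I * τ * (h - 1 / 24))

end Diagonal

/-! ### Action of the current modes and generation from the vacuum -/

namespace ChiralBoson

theorem expCoeff_zero (f : PowerSeries (Module.End ℂ Osc)) : expCoeff f 0 = 1 := by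
  simp [expCoeff]

theorem vertexCoeff_zero_one (β : ℝ) : vertexCoeff β 0 1 = 1 := by
  change ∑ᶠ M, vertexTerm β 0 M 1 = 1
  rw [finsum_eq_single _ 0]
  · simp [vertexTerm, expCoeff_zero]
  · intro M hM
    -- The vacuum has level 0, so lowering the level by `M > 0` annihilates it.
    have h1 : (1 : Osc) ∈ lowLevel 0 := by
      rw [mem_lowLevel]
      intro d hd
      have : d = 0 := by
        by_contra h
        exact hd (by rw [MvPolynomial.coeff_one, if_neg (Ne.symm h)])
      simp [this]
    have h0 := eq_zero_of_mem_lowLevel (by omega) (lowers_expCoeff β M 0 1 h1)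
    simp only [vertexTerm]
    split_ifs <;> simp [h0]

theorem J_incl (k : ℕ) (s : ℤˣ) (m n : ℤ) (v : Osc) :
    J k s m (incl k n v) =
      incl k (n + s) (vertexCoeff (charge k s) (-m - k - 2 * k * s * n) v) := by
  simp [J, incl]

/-- The mode number is the one for which the required power of `z` vanishes: `(2i+1)k - k - 2k s² i
= 0`, as `s² = 1`. -/
theorem J_hwv (k : ℕ) (s : ℤˣ) (i : ℤ) :
    J k s (-((2 * i + 1) * k)) (hwv k (s * i)) = hwv k (s * (i + 1)) := by
  have hs : (s : ℤ) * s = 1 := by rw [← Units.val_mul, Int.units_mul_self]; rfl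
  have h0 : -(-((2 * i + 1) * k)) - k - 2 * k * s * (s * i) = (0 : ℤ) := by
    linear_combination (-2 * k * i) * hs
  rw [hwv, J_incl, h0, vertexCoeff_zero_one, hwv, mul_add, mul_one]

theorem prod_J_hwv (k : ℕ) (s : ℤˣ) (n : ℕ) :
    (((List.range n).reverse.map fun i : ℕ => J k s (-((2 * (i : ℤ) + 1) * k))).prod)
      (hwv k 0) = hwv k (s * n) := by
  induction n with
  | zero => simp
  | succ n ih =>
    -- Reversal puts the new mode leftmost, so it acts last.
    rw [List.range_succ, List.reverse_append, List.map_append, List.prod_append,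
      Module.End.mul_apply, ih]
    simpa using J_hwv k s n

theorem J0_neg_incl (k : ℕ) (m : ℕ+) (n : ℤ) (v : Osc) :
    J0 k (-(m : ℕ)) (incl k n v) =
      ((Real.sqrt (2 * k) : ℝ) : ℂ)⁻¹ • incl k n (MvPolynomial.X m * v) := by
  have : heis (charge k n) (-(m : ℕ)) = create m := by
    obtain ⟨j, rfl⟩ : ∃ j : ℕ, m = j.succPNat := ⟨m.natPred, (PNat.succPNat_natPred m).symm⟩
    rfl
  simp [J0, incl, this, create]

theorem map_mem_generated {k : ℕ} {v w : Space k} {T : Module.End ℂ (Space k)}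
    (hT : T ∈ currentAlgebra k) (hw : w ∈ generated k v) : T w ∈ generated k v := by
  obtain ⟨S, hS, rfl⟩ := hw
  exact ⟨T * S, (currentAlgebra k).mul_mem hT hS, rfl⟩

theorem J_mem_currentAlgebra (k : ℕ) (s : ℤˣ) (m : ℤ) : J k s m ∈ currentAlgebra k := by
  refine Algebra.subset_adjoin (Or.inl ?_)
  obtain rfl | rfl := Int.units_eq_one_or s
  · exact Or.inl ⟨m, rfl⟩
  · exact Or.inr ⟨m, rfl⟩

theorem J0_mem_currentAlgebra (k : ℕ) (m : ℤ) : J0 k m ∈ currentAlgebra k :=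
  Algebra.subset_adjoin (Or.inr ⟨m, rfl⟩)

theorem hwv_mem_generated (k : ℕ) (n : ℤ) : hwv k n ∈ generated k (hwv k 0) := by
  have h : ∀ (s : ℤˣ) (n : ℕ), hwv k (s * n) ∈ generated k (hwv k 0) := by
    intro s n
    rw [← prod_J_hwv]
    refine map_mem_generated (list_prod_mem fun T hT => ?_) ⟨1, (currentAlgebra k).one_mem, rfl⟩
    obtain ⟨i, -, rfl⟩ := List.mem_map.1 hT
    exact J_mem_currentAlgebra k s _
  obtain ⟨m, rfl | rfl⟩ := n.eq_nat_or_neg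
  · simpa using h 1 m
  · simpa using h (-1) m

theorem generated_hwv_zero {k : ℕ} (hk : 0 < k) : generated k (hwv k 0) = ⊤ := by
  have hc : ((Real.sqrt (2 * k) : ℝ) : ℂ) ≠ 0 := by
    have : 0 < Real.sqrt (2 * k) := Real.sqrt_pos.2 (by positivity)
    exact_mod_cast this.ne'
  have hincl : ∀ n (p : Osc), incl k n p ∈ generated k (hwv k 0) := by
    intro n p
    -- Constants are multiples of the highest weight vector; multiplication by `X m` is `√(2k)
    -- J^0_{-m}`.
    induction p using MvPolynomial.induction_on with
    | C a =>
      rw [← mul_one (MvPolynomial.C a), MvPolynomial.C_mul', map_smul]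
      exact Submodule.smul_mem _ _ (hwv_mem_generated k n)
    | add p q hp hq =>
      rw [map_add]
      exact add_mem hp hq
    | mul_X p m hp =>
      have h := Submodule.smul_mem _ ((Real.sqrt (2 * k) : ℝ) : ℂ)
        (map_mem_generated (J0_mem_currentAlgebra k (-(m : ℕ))) hp)
      rwa [J0_neg_incl, smul_inv_smul₀ hc, mul_comm] at h
  rw [eq_top_iff]
  rintro v -
  induction v using DirectSum.induction_on with
  | zero => exact zero_mem _
  | of n p => exact hincl n p
  | add v w hv hw => exact add_mem hv hw

/-! ### Spectrum of `L0` and its character -/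

/-- Each `a_{-m} a_m` is `m X_m ∂_m`, which scales a monomial by `m` times its exponent `d m`; these
add up to the weight. -/
theorem fockL0_monomial (α : ℝ) (d : ℕ+ →₀ ℕ) :
    fockL0 α (MvPolynomial.monomial d 1) =
      ((α : ℂ) ^ 2 / 2 + (Finsupp.weight (fun m : ℕ+ => (m : ℕ)) d : ℕ)) •
        (MvPolynomial.monomial d 1 : Osc) := by
  have h1 : ∀ m : ℕ+, (create m * annih m) (MvPolynomial.monomial d 1) =
      ((d m * (m : ℕ) : ℕ) : ℂ) • (MvPolynomial.monomial d 1 : Osc) := by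
    intro m
    have := MvPolynomial.X_mul_pderiv_monomial (R := ℂ) (i := m) (m := d) (r := 1)
    simp only [create, annih, Module.End.mul_apply, LinearMap.smul_apply, LinearMap.mulLeft_apply,
      mul_smul_comm, Derivation.coeFn_coe, this]
    rw [← Nat.cast_smul_eq_nsmul ℂ, smul_smul, mul_comm]
    push_cast
    rfl
  have h2 : pointwiseSum (fun m : ℕ+ => create m * annih m) number_finite
      (MvPolynomial.monomial d 1) =
      ((Finsupp.weight (fun m : ℕ+ => (m : ℕ)) d : ℕ) : ℂ) •
        (MvPolynomial.monomial d 1 : Osc) := by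
    change ∑ᶠ m : ℕ+, (create m * annih m) (MvPolynomial.monomial d 1) = _
    simp_rw [h1]
    rw [finsum_eq_sum_of_support_subset (s := d.support), ← Finset.sum_smul,
      Finsupp.weight_apply, Finsupp.sum]
    · simp
    · intro m hm
      rw [Finset.mem_coe, Finsupp.mem_support_iff]
      rintro h
      exact hm (by simp [h])
  have h3 : heis α 0 = (α : ℂ) • 1 := rfl
  rw [fockL0, LinearMap.add_apply, h2, add_smul, h3]
  congr 1
  simp only [LinearMap.smul_apply, Module.End.mul_apply, Module.End.one_apply, smul_smul]
  congr 1
  ring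

/-- The basis of `⨁ F_{n √(2k)}` formed by the monomials in the creation operators. -/
noncomputable def monomialBasis (k : ℕ) :
    Module.Basis (Σ _ : ℤ, ℕ+ →₀ ℕ) ℂ (Space k) :=
  DFinsupp.basis fun _ : ℤ => MvPolynomial.basisMonomials ℕ+ ℂ

theorem monomialBasis_apply (k : ℕ) (n : ℤ) (d : ℕ+ →₀ ℕ) :
    monomialBasis k ⟨n, d⟩ = incl k n (MvPolynomial.monomial d 1) := by
  classical
  rw [monomialBasis, DFinsupp.basis]
  change (DFinsupp.mapRange.linearEquiv fun _ : ℤ =>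
      (MvPolynomial.basisMonomials ℕ+ ℂ).repr).symm
    (sigmaFinsuppEquivDFinsupp (Finsupp.single (⟨n, d⟩ : Σ _ : ℤ, ℕ+ →₀ ℕ) (1 : ℂ))) = _
  rw [sigmaFinsuppEquivDFinsupp_single]
  exact DFinsupp.mapRange_single (hf := fun _ => map_zero _)

theorem L0_monomialBasis (k : ℕ) (i : Σ _ : ℤ, ℕ+ →₀ ℕ) :
    L0 k (monomialBasis k i) =
      ((k : ℂ) * (i.1 : ℂ) ^ 2 + (Finsupp.weight (fun m : ℕ+ => (m : ℕ)) i.2 : ℕ)) •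
        monomialBasis k i := by
  obtain ⟨n, d⟩ := i
  have hc : ((charge k n : ℝ) : ℂ) ^ 2 / 2 = k * (n : ℂ) ^ 2 := by
    have : (charge k n) ^ 2 / 2 = k * (n : ℝ) ^ 2 := by
      rw [charge, mul_pow, Real.sq_sqrt (by positivity)]
      ring
    exact_mod_cast congrArg (fun x : ℝ => (x : ℂ)) this
  have h : L0 k (incl k n (MvPolynomial.monomial d 1)) =
      incl k n (fockL0 (charge k n) (MvPolynomial.monomial d 1)) := by
    simp [L0, incl]
  rw [monomialBasis_apply, h, fockL0_monomial, map_smul, hc]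

/-- This is the Jacobi theta series at `z = 0` with parameter `2kτ`, whose imaginary part is
positive because `k > 0`. -/
theorem summable_thetaTerm {k : ℕ} (hk : 0 < k) (τ : ℍ) : Summable (thetaTerm k τ) := by
  have h : thetaTerm k τ = fun n => jacobiTheta₂_term n 0 (2 * k * τ) := by
    funext n
    rw [thetaTerm, jacobiTheta₂_term]
    congr 1
    ring
  rw [h, summable_jacobiTheta₂_term_iff]
  have : ((2 * k * τ : ℂ)).im = 2 * k * τ.im := by
    rw [show (2 * k * τ : ℂ) = ((2 * k : ℝ) : ℂ) * τ by push_cast; ring, Complex.im_ofReal_mul]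
    rfl
  rw [this]
  have := τ.im_pos
  positivity

theorem hasSum_chi0 {k : ℕ} (hk : 0 < k) (τ : ℍ) :
    HasSum (fun i : Σ _ : ℤ, ℕ+ →₀ ℕ => Complex.exp (2 * Real.pi * Complex.I * τ *
      ((k : ℂ) * (i.1 : ℂ) ^ 2 + (Finsupp.weight (fun m : ℕ+ => (m : ℕ)) i.2 : ℕ) - 1 / 24)))
      (chi0 k τ) := by
  set q := Complex.exp (2 * Real.pi * Complex.I * τ) with hqdef
  have hq : ‖q‖ < 1 := UpperHalfPlane.norm_exp_two_pi_I_lt_one τ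
  obtain ⟨h1, h2⟩ := hasSum_pow_weight hq
  have hθ := summable_thetaTerm hk τ
  have hmul := summable_mul_of_summable_norm hθ.norm h1
  have h3 := HasSum.mul_left (Complex.exp (2 * Real.pi * Complex.I * τ / 24))⁻¹
    (hθ.hasSum.mul h2 hmul)
  -- The prefactor `q^{1/24}` of `η` accounts for the shift `-1/24` in the exponents.
  have hη : ModularForm.eta τ = Complex.exp (2 * Real.pi * Complex.I * τ / 24) *
      ∏' n : ℕ, (1 - q ^ (n + 1)) := by
    simp_rw [ModularForm.eta, ModularForm.eta_q_eq_pow, Function.Periodic.qParam]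
    simp [hqdef]
  have hχ : chi0 k τ = (Complex.exp (2 * Real.pi * Complex.I * τ / 24))⁻¹ *
      ((∑' n : ℤ, thetaTerm k τ n) * (∏' n : ℕ, (1 - q ^ (n + 1)))⁻¹) := by
    rw [chi0, hη, div_eq_mul_inv, mul_inv]
    ring
  rw [hχ]
  have h4 := (Equiv.sigmaEquivProd ℤ (ℕ+ →₀ ℕ)).hasSum_iff.2 h3
  refine Eq.mp (congrArg (HasSum · _) (funext fun i => ?_)) h4
  simp only [Function.comp_apply, Equiv.sigmaEquivProd_apply, thetaTerm]
  rw [hqdef, ← Complex.exp_nat_mul, ← Complex.exp_neg, ← Complex.exp_add, ← Complex.exp_add]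
  congr 1
  ring

end ChiralBoson

theorem lemma2 (k : ℕ) (hk : 0 < k) :
    ChiralBoson.generated k (ChiralBoson.hwv k 0) = ⊤ ∧
    (∀ τ : ℍ, Summable (ChiralBoson.thetaTerm k τ)) ∧
    ChiralBoson.IsCharacter (ChiralBoson.L0 k) (ChiralBoson.chi0 k) ∧
    ∀ (s : ℤˣ) (n : ℕ),
      (((List.range n).reverse.map fun i : ℕ =>
        ChiralBoson.J k s (-((2 * (i : ℤ) + 1) * k))).prod) (ChiralBoson.hwv k 0) =
      ChiralBoson.hwv k (s * n) :=
  ⟨ChiralBoson.generated_hwv_zero hk, ChiralBoson.summable_thetaTerm hk,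
    .of_basis (ChiralBoson.monomialBasis k) (ChiralBoson.L0_monomialBasis k)
      (ChiralBoson.hasSum_chi0 hk), ChiralBoson.prod_J_hwv k⟩
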